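/- Let $\alpha \in \mathbb{Z}$ be any integer, and let $E_\alpha/\mathbb{Q}$ be the curve given by the Weierstrass equation $$E_\alpha:\ y^2-\alpha xy = x^3-(\alpha^2+5).$$ Then $E_\alpha$ is an elliptic curve (its discriminant is nonzero), and there is no non-trivial torsion point $P=(x_0,y_0)\in E_\alpha(\mathbb{Q})$ such that $2 \mid \mathrm{Num}(x_0)$, where $\mathrm{Num}(x_0)$ denotes the numerator of the rational number $x_0$ written in lowest terms. -/

import Mathlib

/-- The Weierstrass curve `E_α : y² - α x y = x³ - (α² + 5)` over `ℚ`, for an integer `α`. -/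
def fruitCurve (α : ℤ) : WeierstrassCurve ℚ where
  a₁ := -(α : ℚ)
  a₂ := 0
  a₃ := 0
  a₄ := 0
  a₆ := -((α : ℚ) ^ 2 + 5)

/-- The affine equation of `fruitCurve α` is the intended one. -/
theorem fruitCurve_equation_iff (α : ℤ) (x y : ℚ) :
    (fruitCurve α).toAffine.Equation x y ↔
      y ^ 2 - (α : ℚ) * x * y = x ^ 3 - ((α : ℚ) ^ 2 + 5) := by
  rw [WeierstrassCurve.Affine.equation_iff]
  simp only [fruitCurve]
  constructor <;> intro h <;> linarith

/-! Torsion plays no role: no rational point has `x = a/b` with `a` even. Scaling by `b⁴` makes `Y =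
b²y` a root of a monic integral quadratic, hence an integer, and the resulting equation fails modulo
4. -/

/-- The discriminant of `fruitCurve α` in closed form. -/
theorem fruitCurve_discr (α : ℤ) :
    (fruitCurve α).Δ = (((α ^ 2 + 5) * (α ^ 6 - 432 * α ^ 2 - 2160) : ℤ) : ℚ) := by
  simp only [WeierstrassCurve.Δ, WeierstrassCurve.b₂, WeierstrassCurve.b₄, WeierstrassCurve.b₆,
    WeierstrassCurve.b₈, fruitCurve]
  push_cast
  ring

theorem fruitCurve_discr_ne_zero (α : ℤ) : (fruitCurve α).Δ ≠ 0 := by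
  rw [fruitCurve_discr, Int.cast_ne_zero]
  refine mul_ne_zero (by positivity) fun h => ?_
  -- For `t = α² ≥ 25`, `t³ ≥ 625t > 432t + 2160`.
  obtain hα | hα : |α| ≤ 4 ∨ 5 ≤ |α| := by omega
  · obtain ⟨h₁, h₂⟩ := abs_le.mp hα
    interval_cases α <;> omega
  · have hsq : 25 ≤ α ^ 2 := by nlinarith [sq_abs α]
    nlinarith [mul_nonneg (sq_nonneg α) (mul_nonneg (sub_nonneg.mpr hsq) (sq_nonneg α)),
      mul_nonneg (sub_nonneg.mpr hsq) (sq_nonneg α)]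

instance fruitCurve_isElliptic (α : ℤ) : (fruitCurve α).IsElliptic :=
  ⟨(fruitCurve_discr_ne_zero α).isUnit⟩

/-- A rational root of a monic integral quadratic polynomial is an integer. -/
theorem Rat.exists_int_eq_of_sq_add_mul_add_eq_zero (m n : ℤ) (r : ℚ)
    (h : r ^ 2 + m * r + n = 0) : ∃ k : ℤ, (k : ℚ) = r := by
  have hr : IsIntegral ℤ r := by
    refine ⟨Polynomial.X ^ 2 + (Polynomial.C m * Polynomial.X + Polynomial.C n), ?_, ?_⟩
    · exact Polynomial.monic_X_pow_add
        (Polynomial.degree_linear_le.trans_lt (by norm_num))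
    · simp only [Polynomial.eval₂_add, Polynomial.eval₂_mul, Polynomial.eval₂_pow,
        Polynomial.eval₂_X, Polynomial.eval₂_C]
      rw [eq_intCast, eq_intCast]
      linear_combination h
  simpa using IsIntegrallyClosed.isIntegral_iff.mp hr

/-- The homogenised equation of the fruit curves is insoluble modulo `4` when the numerator `a`
of the `x`-coordinate is even and its denominator `b` is odd. -/
theorem fruit_equation_ne_of_even_of_odd (α a b Y : ℤ) (ha : Even a) (hb : Odd b) :
    Y ^ 2 - α * a * b * Y ≠ a ^ 3 * b - (α ^ 2 + 5) * b ^ 4 := by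
  obtain ⟨c, rfl⟩ := ha
  intro h
  have h4 := congrArg (Int.cast : ℤ → ZMod 4) h
  push_cast at h4
  have hb4 : (b : ZMod 4) = 1 ∨ (b : ZMod 4) = 3 := by
    obtain ⟨d, rfl⟩ := hb
    push_cast
    generalize (d : ZMod 4) = d
    revert d
    decide
  generalize (α : ZMod 4) = α at h4
  generalize (c : ZMod 4) = c at h4
  generalize (Y : ZMod 4) = Y at h4
  -- With `a = 2c` this reads `Y² + α² + 1 = 2αcbY`: parity forces exactly one of `Y`, `α` odd, and
  -- then `2 = 0`.
  rcases hb4 with hb4 | hb4 <;> rw [hb4] at h4 <;> revert α c Y <;> decide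

/-- No rational point of `fruitCurve α` has an `x`-coordinate with even numerator. -/
theorem fruitCurve_not_two_dvd_num (α : ℤ) {x y : ℚ}
    (h : (fruitCurve α).toAffine.Equation x y) : ¬ 2 ∣ x.num := by
  intro hx
  rw [fruitCurve_equation_iff] at h
  have hden : Odd (x.den : ℤ) := by
    rw [← Int.not_even_iff_odd, even_iff_two_dvd]
    intro hd
    have hdvd := Nat.dvd_gcd (Int.natAbs_dvd_natAbs.mpr hx) (Int.natCast_dvd_natCast.mp hd)
    rw [x.reduced.gcd_eq_one] at hdvd
    norm_num at hdvd
  have hnum : (x.num : ℚ) = x * x.den := (Rat.mul_den_eq_num x).symm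
  have hscaled : ((x.den : ℚ) ^ 2 * y) ^ 2 - α * x.num * x.den * (x.den ^ 2 * y) =
      x.num ^ 3 * x.den - (α ^ 2 + 5) * x.den ^ 4 := by
    rw [hnum]
    linear_combination (x.den : ℚ) ^ 4 * h
  obtain ⟨Y, hY⟩ := Rat.exists_int_eq_of_sq_add_mul_add_eq_zero (-(α * x.num * x.den))
    (-(x.num ^ 3 * x.den - (α ^ 2 + 5) * x.den ^ 4)) ((x.den : ℚ) ^ 2 * y) (by
      push_cast
      linear_combination hscaled)
  rw [← hY] at hscaled
  exact fruit_equation_ne_of_even_of_odd α x.num x.den Y (even_iff_two_dvd.mpr hx) hden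
    (by exact_mod_cast hscaled)

theorem mainTheorem6 (α : ℤ) :
    (fruitCurve α).IsElliptic ∧
      ¬ ∃ (x₀ y₀ : ℚ) (h : (fruitCurve α).toAffine.Nonsingular x₀ y₀),
        IsOfFinAddOrder (WeierstrassCurve.Affine.Point.some x₀ y₀ h) ∧ 2 ∣ x₀.num := by
  refine ⟨fruitCurve_isElliptic α, ?_⟩
  rintro ⟨x₀, y₀, h, -, hx⟩
  exact fruitCurve_not_two_dvd_num α h.1 hx
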